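/- Let $R$ be a commutative Noetherian ring, $X\subseteq\operatorname{Spec}R$ a saturated subset (that is, $V(\mathfrak p)=\{\mathfrak q\in\operatorname{Spec}R:\mathfrak p\subseteq\mathfrak q\}\subseteq X$ for every $\mathfrak p\in X$; the empty set is allowed), $I$ an ideal of $R$, and $M$ a strongly representable linearly compact $R$-module. Here an $R$-module is *secondary* if it is nonzero and every $a\in R$ acts on it either surjectively or nilpotently; it is *representable* if it is the sum of finitely many secondary submodules (the zero module being the empty sum); $M$ is *strongly representable* if $M$ is representable and $(0:_M J)=\{m\in M: Jm=0\}$ is representable for every finitely generated ideal $J$ of $R$. $M$ is *linearly compact* if it carries a Hausdorff topology making it a topological abelian group, with a neighbourhood basis of $0$ consisting of submodules, such that every family of cosets of closed submodules with the finite intersection property has nonempty intersection. The *co-support* of an $R$-module $L$ is $\operatorname{Cos}_R L=\{\mathfrak p\in\operatorname{Spec}R:\operatorname{Hom}_R(R_{\mathfrak p},L)\neq 0\}$. A sequence $x_1,\dots,x_n\in R$ is *$M$-filter co-regular with respect to $X$* if $$\operatorname{Cos}_R\bigl((0:_M(x_1,\dots,x_{i-1}))/x_i(0:_M(x_1,\dots,x_{i-1}))\bigr)\subseteq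 X\qquad\text{for } i=1,\dots,n.$$ Then for every integer $n>0$ the following conditions are equivalent: (i) $\operatorname{Cos}_R(\operatorname{Tor}_i^R(N,M))\subseteq X$ for all $0\le i<n$ and every finitely generated $R$-module $N$ with $\operatorname{Supp}_R N\subseteq V(I)$; (ii) $\operatorname{Cos}_R(\operatorname{Tor}_i^R(R/I,M))\subseteq X$ for all $0\le i<n$; (iii) there is an $M$-filter co-regular sequence with respect to $X$ of length $n$ contained in $I$. -/

import Mathlib

universe u

/-- The co-support `Cos_R M` of an `R`-module `M`: the primes `p` with `Hom_R(R_p, M) ≠ 0`. -/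
def coSupport (R : Type*) [CommRing R] (M : Type*) [AddCommGroup M] [Module R M] :
    Set (PrimeSpectrum R) :=
  {p | Nontrivial (Localization.AtPrime p.asIdeal →ₗ[R] M)}

/-- A saturated subset of `Spec R`: it contains `V(p)` together with each of its points `p`.
The empty set is saturated. -/
def IsSaturatedSubset {R : Type*} [CommRing R] (X : Set (PrimeSpectrum R)) : Prop :=
  ∀ p ∈ X, PrimeSpectrum.zeroLocus (p.asIdeal : Set R) ⊆ X

/-- A secondary module: a nonzero module on which every ring element acts either surjectively
or nilpotently. -/
def IsSecondaryModule (R : Type*) [CommRing R] (M : Type*) [AddCommGroup M] [Module R M] : Prop :=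
  Nontrivial M ∧
    ∀ a : R, (Function.Surjective fun m : M => a • m) ∨ ∃ k : ℕ, ∀ m : M, a ^ k • m = 0

/-- A representable module: a finite sum of secondary submodules. The zero module is the empty
sum. -/
def IsRepresentableModule (R : Type*) [CommRing R] (M : Type*) [AddCommGroup M] [Module R M] :
    Prop :=
  ∃ s : Finset (Submodule R M), (∀ N ∈ s, IsSecondaryModule R N) ∧ s.sup id = ⊤

/-- The submodule `(0 :_M I)` of the elements of `M` that are annihilated by `I`. -/
abbrev colonZero {R : Type*} [CommRing R] (M : Type*) [AddCommGroup M] [Module R M]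
    (I : Ideal R) : Submodule R M :=
  Submodule.torsionBySet R M (I : Set R)

/-- A strongly representable module: `M` is representable, and so is `(0 :_M I)` for every finitely
generated ideal `I`. -/
def IsStronglyRepresentable (R : Type*) [CommRing R] (M : Type*) [AddCommGroup M] [Module R M] :
    Prop :=
  IsRepresentableModule R M ∧ ∀ I : Ideal R, I.FG → IsRepresentableModule R (colonZero M I)

/-- A linearly compact module: a Hausdorff topological group whose topology is linear
(`0` has a neighbourhood basis of submodules), such that every family of cosets of closed
submodules with the finite intersection property has nonempty intersection.
(The ring carries no topology; each scalar acts continuously because the topology is linear.) -/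
structure IsLinearlyCompactModule (R : Type*) [CommRing R] (M : Type*) [AddCommGroup M]
    [Module R M] [TopologicalSpace M] : Prop where
  isTopologicalAddGroup : IsTopologicalAddGroup M
  t2Space : T2Space M
  isLinearTopology : IsLinearTopology R M
  sInter_nonempty : ∀ F : Set (Set M),
    (∀ C ∈ F, ∃ (m : M) (N : Submodule R M),
      IsClosed (N : Set M) ∧ C = (fun y => m + y) '' (N : Set M)) →
    (∀ G ⊆ F, G.Finite → (⋂₀ G).Nonempty) → (⋂₀ F).Nonempty

/-- The sequence `x_0, …, x_{n-1}` of ring elements is `M`-filter co-regular with respect to `X`: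
for each `i`, with `T = (0 :_M (x_0, …, x_{i-1}))`, one has `Cos_R (T / x_i T) ⊆ X`. -/
def IsFilterCoregular {R : Type*} [CommRing R] (M : Type*) [AddCommGroup M] [Module R M]
    (X : Set (PrimeSpectrum R)) {n : ℕ} (x : Fin n → R) : Prop :=
  ∀ i : Fin n,
    coSupport R
      (colonZero M (Ideal.span (x '' Set.Iio i)) ⧸
        LinearMap.range
          (LinearMap.lsmul R (colonZero M (Ideal.span (x '' Set.Iio i))) (x i))) ⊆ X

/-- `Tor_i^R(N, M)`, computed from a projective resolution of `N`. -/
noncomputable abbrev torModule (R : Type u) [CommRing R] (i : ℕ) (N M : Type u)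
    [AddCommGroup N] [Module R N] [AddCommGroup M] [Module R M] : ModuleCat.{u} R :=
  ((CategoryTheory.Tor' (ModuleCat.{u} R) i).obj (ModuleCat.of R N)).obj (ModuleCat.of R M)

/-! Fix a prime `p` outside `X` and put `L = Hom_R(R_p, M)`. Linear compactness makes `Hom_R(R_p,
-)` preserve exactness along continuous maps: a homomorphism out of a localization is a compatible
family, so lifting one is an intersection problem for closed cosets in a product
(`IsLinearlyCompactModule.exists_hom_forall_mem`). Let `P` be a resolution of `N` by free modules of
finite rank. Every module in `P ⊗ M` is a finite power of `M`, so `p` lies outside the co-support of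
`Tor_i(N, M)` exactly when `P ⊗ L` is exact in degree `i` (`notMem_coSupport_torModule_iff`). In the
same way, filter co-regularity says that `x_i` acts surjectively on `(0 :_L (x_0, …, x_{i-1}))` for
all such `p`.

What remains is algebra with `K = (0 :_L J)`, on which `x` acts surjectively, and the sequence `0 →
(0 :_K x) → K → K → 0`. From vanishing of Tor to sequences, each new element costs one degree of
exactness (`ExactAt.inf_ker`). In the other direction, exactness one degree lower for `(0 :_K x)`
makes `x` surjective on the homology of `P ⊗ K`, which a power of `x` kills
(`exactAt_of_forall_exists_smul_eq`).

The next element of a sequence comes from exactness in degree zero, that is `K = I K`. Strong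
representability gives `(0 :_M J)` a secondary representation; `K = I K` forces `I` out of the prime
of every irredundant component with prime outside `X`, and prime avoidance yields one element of `I`
that works for all `p ∉ X` at once (`exists_mem_forall_exists_smul_eq`). -/

open Topology Filter TensorProduct

/-! ### Linear topologies and cosets of closed submodules -/

section LinearTopology

variable {R : Type*} [CommRing R]

theorem IsLinearTopology.continuousConstSMul (R A : Type*) [CommRing R] [AddCommGroup A]
    [Module R A] [TopologicalSpace A] [IsTopologicalAddGroup A] [IsLinearTopology R A] :
    ContinuousConstSMul R A := by
  refine ⟨fun r => continuous_of_continuousAt_zero (DistribSMul.toAddMonoidHom A r) ?_⟩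
  have := IsLinearTopology.tendsto_smul_zero R (fun _ : A => r) (fun a : A => a)
    (tendsto_id (α := A) (x := 𝓝 0))
  rw [ContinuousAt, map_zero]
  exact this

instance Pi.instIsLinearTopology {ι : Type*} {A : ι → Type*} [∀ i, AddCommGroup (A i)]
    [∀ i, Module R (A i)] [∀ i, TopologicalSpace (A i)]
    [∀ i, IsLinearTopology R (A i)] : IsLinearTopology R (∀ i, A i) := by
  rw [isLinearTopology_iff_hasBasis_submodule]
  refine ⟨fun t => ⟨fun ht => ?_, fun ⟨N, hN, hNt⟩ => mem_of_superset hN hNt⟩⟩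
  rw [nhds_pi, Filter.mem_pi] at ht
  obtain ⟨s, hs, u, hu, hut⟩ := ht
  choose N hN hNu using fun i => (IsLinearTopology.hasBasis_submodule R).mem_iff.mp (hu i)
  refine ⟨Submodule.pi s N, ?_, fun y hy => hut fun i hi => hNu i (hy i hi)⟩
  rw [nhds_pi, Filter.mem_pi]
  exact ⟨s, hs, fun i => N i, hN, fun y hy => hy⟩

instance Submodule.instIsLinearTopology {A : Type*} [AddCommGroup A] [Module R A]
    [TopologicalSpace A] [IsLinearTopology R A] (K : Submodule R A) : IsLinearTopology R K := by
  have h := (IsLinearTopology.hasBasis_submodule R (M := A)).comap (K.subtype : K → A)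
  rw [show Filter.comap (K.subtype : K → A) (𝓝 0) = 𝓝 (0 : K) from nhds_subtype_eq_comap.symm] at h
  exact IsLinearTopology.mk_of_hasBasis (S := Submodule R K) R
    (s := fun N : Submodule R A => N.comap K.subtype) h

end LinearTopology

/-- A coset of a closed submodule. -/
def IsClosedCoset (R : Type*) [CommRing R] {A : Type*} [AddCommGroup A] [Module R A]
    [TopologicalSpace A] (C : Set A) : Prop :=
  ∃ (m : A) (N : Submodule R A), IsClosed (N : Set A) ∧ C = (fun y => m + y) '' (N : Set A)

section ClosedCoset

variable {R : Type*} [CommRing R] {A : Type*} [AddCommGroup A] [Module R A] [TopologicalSpace A]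

omit [TopologicalSpace A] in
theorem Submodule.mem_translate {N : Submodule R A} {m y : A} :
    y ∈ (fun y => m + y) '' (N : Set A) ↔ y - m ∈ N := by
  constructor
  · rintro ⟨z, hz, rfl⟩
    simpa using hz
  · exact fun h => ⟨y - m, h, by simp⟩

theorem isClosedCoset_of_mem {C : Set A} {m : A} {N : Submodule R A} (hN : IsClosed (N : Set A))
    (h : ∀ y, y ∈ C ↔ y - m ∈ N) : IsClosedCoset R C :=
  ⟨m, N, hN, by ext y; rw [h, Submodule.mem_translate]⟩

theorem IsClosedCoset.exists_submodule {C : Set A} (hC : IsClosedCoset R C) :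
    ∃ N : Submodule R A, IsClosed (N : Set A) ∧ ∀ m ∈ C, ∀ y, y ∈ C ↔ y - m ∈ N := by
  obtain ⟨m, N, hN, rfl⟩ := hC
  refine ⟨N, hN, fun m' hm' y => ?_⟩
  rw [Submodule.mem_translate] at hm' ⊢
  rw [← N.sub_mem_iff_left hm', sub_sub_sub_cancel_right]

theorem IsClosedCoset.nonempty {C : Set A} (hC : IsClosedCoset R C) : C.Nonempty := by
  obtain ⟨m, N, -, rfl⟩ := hC
  exact ⟨m, Submodule.mem_translate.mpr (by simp)⟩

theorem IsClosedCoset.univ : IsClosedCoset R (Set.univ : Set A) :=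
  isClosedCoset_of_mem (m := 0) (N := ⊤) isClosed_univ (by simp)

theorem IsClosedCoset.inter {C D : Set A} (hC : IsClosedCoset R C) (hD : IsClosedCoset R D)
    (h : (C ∩ D).Nonempty) : IsClosedCoset R (C ∩ D) := by
  obtain ⟨m, hmC, hmD⟩ := h
  obtain ⟨N, hN, hC⟩ := hC.exists_submodule
  obtain ⟨K, hK, hD⟩ := hD.exists_submodule
  exact isClosedCoset_of_mem (m := m) (N := N ⊓ K) (hN.inter hK) fun y => by
    rw [Set.mem_inter_iff, hC m hmC, hD m hmD, Submodule.mem_inf]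

theorem IsClosedCoset.preimage {B : Type*} [AddCommGroup B] [Module R B] [TopologicalSpace B]
    {C : Set B} (hC : IsClosedCoset R C) (f : A →ₗ[R] B) (hf : Continuous f)
    (h : (f ⁻¹' C).Nonempty) : IsClosedCoset R (f ⁻¹' C) := by
  obtain ⟨m, hm⟩ := h
  obtain ⟨N, hN, hC⟩ := hC.exists_submodule
  exact isClosedCoset_of_mem (m := m) (N := N.comap f) (hN.preimage hf) fun y => by
    rw [Set.mem_preimage, hC _ hm, Submodule.mem_comap, map_sub]

theorem IsClosedCoset.sInter_of_finite {G : Set (Set A)} (hG : G.Finite)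
    (h : ∀ C ∈ G, IsClosedCoset R C) (hne : (⋂₀ G).Nonempty) : IsClosedCoset R (⋂₀ G) := by
  induction G, hG using Set.Finite.induction_on with
  | empty => simpa using IsClosedCoset.univ
  | insert _ _ ih =>
    rw [Set.sInter_insert] at hne ⊢
    exact (h _ (Set.mem_insert _ _)).inter
      (ih (fun C hC => h C (Set.mem_insert_of_mem _ hC)) (hne.mono Set.inter_subset_right)) hne

variable [IsTopologicalAddGroup A]

theorem IsClosedCoset.isClosed {C : Set A} (hC : IsClosedCoset R C) : IsClosed C := by
  obtain ⟨m, N, hN, rfl⟩ := hC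
  exact (Homeomorph.addLeft m).isClosedMap _ hN

variable [IsLinearTopology R A]

theorem exists_isClosedCoset_subset_nhds {a : A} {u : Set A} (hu : u ∈ 𝓝 a) :
    ∃ C, IsClosedCoset R C ∧ IsOpen C ∧ a ∈ C ∧ C ⊆ u := by
  have h : (fun y => a + y) ⁻¹' u ∈ 𝓝 (0 : A) :=
    (continuous_const_add a).continuousAt (by simpa using hu)
  obtain ⟨N, hN, hNu⟩ := (IsLinearTopology.hasBasis_open_submodule R).mem_iff.mp h
  refine ⟨(fun y => a + y) '' (N : Set A), ⟨a, N, ?_, rfl⟩,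
    (Homeomorph.addLeft a).isOpenMap _ hN, ⟨0, N.zero_mem, by simp⟩, ?_⟩
  · exact N.toAddSubgroup.isClosed_of_isOpen hN
  · rintro _ ⟨y, hy, rfl⟩
    exact hNu hy

theorem IsClosedCoset.closure_image {B : Type*} [AddCommGroup B] [Module R B]
    {C : Set B} [TopologicalSpace B] (hC : IsClosedCoset R C) (f : B →ₗ[R] A) :
    IsClosedCoset R (closure (f '' C)) := by
  have := IsLinearTopology.continuousConstSMul R A
  obtain ⟨m, N, -, rfl⟩ := hC
  refine ⟨f m, (N.map f).topologicalClosure, (N.map f).isClosed_topologicalClosure, ?_⟩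
  rw [Submodule.topologicalClosure_coe]
  have := (Homeomorph.addLeft (f m)).image_closure (N.map f : Set A)
  simp only [Homeomorph.coe_addLeft] at this
  rw [this, Submodule.map_coe, Set.image_image, Set.image_image]
  simp only [map_add]

end ClosedCoset

/-! ### Permanence of linear compactness -/

namespace IsLinearlyCompactModule

variable {R : Type*} [CommRing R] {A : Type*} [AddCommGroup A] [Module R A] [TopologicalSpace A]

/-- Tychonoff's argument, with closed cosets in place of closed sets: enlarge the family to a
maximal one `G` with the finite intersection property and choose in each factor a point `a i` in the
closures of all projections. By maximality `G` contains the preimages of small open cosets around `a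
i`, so `a` is adherent to every member. -/
theorem pi {ι : Type*} {A : ι → Type*} [∀ i, AddCommGroup (A i)] [∀ i, Module R (A i)]
    [∀ i, TopologicalSpace (A i)] (h : ∀ i, IsLinearlyCompactModule R (A i)) :
    IsLinearlyCompactModule R (∀ i, A i) := by
  have := fun i => (h i).isTopologicalAddGroup
  have := fun i => (h i).t2Space
  have := fun i => (h i).isLinearTopology
  refine ⟨inferInstance, inferInstance, inferInstance, fun F hF hfip => ?_⟩
  let S : Set (Set (Set (∀ i, A i))) :=
    {G | (∀ C ∈ G, IsClosedCoset R C) ∧ ∀ G' ⊆ G, G'.Finite → (⋂₀ G').Nonempty}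
  obtain ⟨G, hFG, hG⟩ := zorn_subset_nonempty S (by
    intro c hc hchain hne
    refine ⟨⋃₀ c, ⟨?_, ?_⟩, fun s hs => Set.subset_sUnion_of_mem hs⟩
    · rintro C ⟨G, hG, hC⟩
      exact (hc hG).1 C hC
    · intro G' hG' hfin
      obtain ⟨t, ht, hsub⟩ :=
        hchain.directedOn.exists_mem_subset_of_finite_of_subset_sUnion hne hfin hG'
      exact (hc ht).2 G' hsub hfin) F ⟨hF, hfip⟩
  obtain ⟨⟨hcos, hGfip⟩, hmax⟩ := hG
  have hmem : ∀ C, IsClosedCoset R C →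
      (∀ G' ⊆ G, G'.Finite → (C ∩ ⋂₀ G').Nonempty) → C ∈ G := by
    intro C hC h
    refine hmax (y := insert C G) ⟨?_, ?_⟩ (Set.subset_insert _ _) (Set.mem_insert _ _)
    · rintro D (rfl | hD)
      exacts [hC, hcos D hD]
    · intro G' hG' hfin
      refine (h (G' \ {C}) ?_ (hfin.subset Set.sdiff_subset)).mono ?_
      · rintro D ⟨hD, hDC⟩
        exact (hG' hD).resolve_left hDC
      · rintro y ⟨hyC, hy⟩ D hD
        by_cases hDC : D = C
        · exact hDC ▸ hyC
        · exact hy D ⟨hD, hDC⟩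
  have hinter : ∀ G' ⊆ G, G'.Finite → ⋂₀ G' ∈ G := by
    intro G' hG' hfin
    refine hmem _ (.sInter_of_finite hfin (fun C hC => hcos C (hG' hC)) (hGfip G' hG' hfin)) ?_
    intro G'' hG'' hfin'
    rw [← Set.sInter_union]
    exact hGfip _ (Set.union_subset hG' hG'') (hfin.union hfin')
  have hpt : ∀ i, ∃ a : A i, ∀ C ∈ G, a ∈ closure ((fun y : ∀ i, A i => y i) '' C) := by
    intro i
    obtain ⟨a, ha⟩ := (h i).sInter_nonempty
      ((fun C => closure ((fun y : ∀ i, A i => y i) '' C)) '' G) (by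
        rintro _ ⟨C, hC, rfl⟩
        exact (hcos C hC).closure_image (LinearMap.proj i)) (by
        intro H hH hfin
        obtain ⟨G', hG', hfin', rfl⟩ :=
          Set.exists_subset_image_finite_and (p := (H = ·)).mp ⟨H, hH, hfin, rfl⟩
        obtain ⟨y, hy⟩ := hGfip G' hG' hfin'
        refine ⟨y i, ?_⟩
        rintro _ ⟨C, hC, rfl⟩
        exact subset_closure ⟨y, hy C hC, rfl⟩)
    exact ⟨a, fun C hC => ha _ ⟨C, hC, rfl⟩⟩
  choose a ha using hpt
  have hpre : ∀ i, ∀ u ∈ 𝓝 (a i), ∃ D ∈ G, D ⊆ (fun y : ∀ i, A i => y i) ⁻¹' u := by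
    intro i u hu
    obtain ⟨C, hC, hCo, haC, hCu⟩ := exists_isClosedCoset_subset_nhds (R := R) hu
    refine ⟨(LinearMap.proj i : (∀ i, A i) →ₗ[R] A i) ⁻¹' C, hmem _ (hC.preimage _
      (continuous_apply i) ⟨a, haC⟩) ?_, Set.preimage_mono hCu⟩
    intro G' hG' hfin
    obtain ⟨_, hb, y, hy, rfl⟩ :=
      mem_closure_iff.mp (ha i _ (hinter G' hG' hfin)) C hCo haC
    exact ⟨y, hb, hy⟩
  refine ⟨a, fun C hC => ?_⟩
  rw [← (hcos C (hFG hC)).isClosed.closure_eq, mem_closure_iff_nhds]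
  intro t ht
  rw [nhds_pi, Filter.mem_pi] at ht
  obtain ⟨s, hs, u, hu, hut⟩ := ht
  choose D hD hDu using fun i => hpre i (u i) (hu i)
  obtain ⟨y, hy⟩ := hGfip (insert C (D '' s))
    (Set.insert_subset (hFG hC) (by rintro _ ⟨i, -, rfl⟩; exact hD i)) ((hs.image D).insert C)
  exact ⟨y, hut fun i hi => hDu i (hy _ (Set.mem_insert_of_mem _ ⟨i, hi, rfl⟩)),
    hy C (Set.mem_insert _ _)⟩

theorem submodule (h : IsLinearlyCompactModule R A) {K : Submodule R A}
    (hK : IsClosed (K : Set A)) : IsLinearlyCompactModule R K := by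
  have := h.isTopologicalAddGroup
  have := h.t2Space
  have := h.isLinearTopology
  refine ⟨inferInstanceAs (IsTopologicalAddGroup K.toAddSubgroup), inferInstance, inferInstance,
    fun F hF hfip => ?_⟩
  by_cases hne : F.Nonempty
  swap
  · exact ⟨0, by simp [Set.not_nonempty_iff_eq_empty.mp hne]⟩
  obtain ⟨a, ha⟩ := h.sInter_nonempty ((fun C => K.subtype '' C) '' F) (by
    rintro _ ⟨C, hC, rfl⟩
    obtain ⟨m, N, hN, rfl⟩ := hF C hC
    refine ⟨m, N.map K.subtype, hK.isClosedEmbedding_subtypeVal.isClosedMap _ hN, ?_⟩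
    rw [Submodule.map_coe, Set.image_image]
    exact Set.image_image _ _ _) (by
    intro H hH hfin
    obtain ⟨G, hG, hfin', rfl⟩ :=
          Set.exists_subset_image_finite_and (p := (H = ·)).mp ⟨H, hH, hfin, rfl⟩
    obtain ⟨y, hy⟩ := hfip G hG hfin'
    refine ⟨y, ?_⟩
    rintro _ ⟨C, hC, rfl⟩
    exact ⟨y, hy C hC, rfl⟩)
  obtain ⟨C, hC⟩ := hne
  obtain ⟨b, -, rfl⟩ := ha _ ⟨C, hC, rfl⟩
  refine ⟨b, fun D hD => ?_⟩
  obtain ⟨b', hb', h'⟩ := ha _ ⟨D, hD, rfl⟩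
  rwa [← Subtype.ext h']

/-- For `b` in the closure, the preimages of the open cosets around `b` have the finite intersection
property; since `B` is Hausdorff, a common point maps to `b`. -/
theorem isClosed_range (h : IsLinearlyCompactModule R A) {B : Type*} [AddCommGroup B] [Module R B]
    [TopologicalSpace B] [IsTopologicalAddGroup B] [T2Space B] [IsLinearTopology R B]
    {f : A →ₗ[R] B} (hf : Continuous f) : IsClosed (LinearMap.range f : Set B) := by
  refine isClosed_of_closure_subset fun b hb => ?_
  obtain ⟨a, ha⟩ := h.sInter_nonempty
    ((fun C => f ⁻¹' C) '' {C | IsClosedCoset R C ∧ IsOpen C ∧ b ∈ C}) (by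
      rintro _ ⟨C, ⟨hC, hCo, hbC⟩, rfl⟩
      obtain ⟨_, hc, a, rfl⟩ := mem_closure_iff.mp hb C hCo hbC
      exact hC.preimage f hf ⟨a, hc⟩) (by
      intro H hH hfin
      obtain ⟨G, hG, hfin', rfl⟩ :=
          Set.exists_subset_image_finite_and (p := (H = ·)).mp ⟨H, hH, hfin, rfl⟩
      obtain ⟨_, hc, a, rfl⟩ := mem_closure_iff.mp hb (⋂₀ G)
        (hfin'.isOpen_sInter fun C hC => (hG hC).2.1) (fun C hC => (hG hC).2.2)
      refine ⟨a, ?_⟩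
      rintro _ ⟨C, hC, rfl⟩
      exact hc C hC)
  refine ⟨a, ?_⟩
  by_contra hne
  obtain ⟨C, hC, hCo, hbC, hCa⟩ := exists_isClosedCoset_subset_nhds (R := R)
    (isOpen_compl_singleton.mem_nhds (x := b) (s := {f a}ᶜ) (by simpa using Ne.symm hne))
  exact hCa (ha _ ⟨C, ⟨hC, hCo, hbC⟩, rfl⟩) rfl

end IsLinearlyCompactModule

theorem LinearMap.isClosed_ker_of_continuous {R A B : Type*} [CommRing R] [AddCommGroup A]
    [Module R A] [TopologicalSpace A] [AddCommGroup B] [Module R B] [TopologicalSpace B]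
    [T1Space B] {f : A →ₗ[R] B} (hf : Continuous f) : IsClosed (LinearMap.ker f : Set A) := by
  rw [show (LinearMap.ker f : Set A) = f ⁻¹' {0} by ext; simp]
  exact isClosed_singleton.preimage hf


/-! ### Homomorphisms from a localization into a linearly compact module -/

theorem Localization.smul_mk_one_mul {R : Type*} [CommRing R] {S : Submonoid R} (s t : S) :
    (t : R) • (Localization.mk 1 (s * t) : Localization S) = Localization.mk 1 s := by
  rw [Localization.smul_mk, smul_eq_mul, mul_one]
  exact Localization.mk_eq_mk_iff.mpr (Localization.r_of_eq (by push_cast; ring))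

/-- Compatible families in a module, indexed by a multiplicative set `S`, are the homomorphisms
out of `S⁻¹R`. -/
theorem exists_localization_hom {R : Type*} [CommRing R] (S : Submonoid R) {A : Type*}
    [AddCommGroup A] [Module R A] (a : S → A) (ha : ∀ s t : S, (t : R) • a (s * t) = a s) :
    ∃ φ : Localization S →ₗ[R] A, ∀ s, φ (Localization.mk 1 s) = a s := by
  let f : Localization S → A := fun z => Localization.liftOn z (fun r s => r • a s) (by
    intro r r' s s' h
    obtain ⟨u, hu⟩ := Localization.r_iff_exists.mp h
    rw [← ha s (s' * u), ← ha s' (s * u), smul_smul, smul_smul,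
      mul_left_comm s' s u]
    congr 1
    push_cast
    linear_combination hu)
  have hf : ∀ r s, f (Localization.mk r s) = r • a s := fun r s => rfl
  refine ⟨{ toFun := f, map_add' := ?_, map_smul' := ?_ }, fun s => ?_⟩
  · intro x y
    induction x using Localization.induction_on with | _ x
    induction y using Localization.induction_on with | _ y
    rw [Localization.add_mk, hf, hf, hf, add_smul, mul_smul, mul_smul]
    rw [add_comm, ← ha x.2 y.2, ← ha y.2 x.2, mul_comm y.2 x.2, smul_comm (y.2 : R),
      smul_comm (x.2 : R)]
  · intro r x
    induction x using Localization.induction_on with | _ x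
    rw [Localization.smul_mk, hf, hf, smul_assoc, RingHom.id_apply]
  · exact (hf 1 s).trans (one_smul _ _)

namespace IsLinearlyCompactModule

variable {R : Type*} [CommRing R] {A : Type*} [AddCommGroup A] [Module R A] [TopologicalSpace A]

/-- An inverse limit of nonempty closed cosets is nonempty. The compatible families with `a s ∈ C s`
form an intersection of closed cosets in the linearly compact module `S → A`, so finitely many
conditions may be treated at a time. -/
theorem exists_hom_forall_mem (h : IsLinearlyCompactModule R A) (S : Submonoid R) (C : S → Set A)
    (hC : ∀ s, IsClosedCoset R (C s))
    (hmul : ∀ s t : S, ∀ a ∈ C (s * t), (t : R) • a ∈ C s) :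
    ∃ φ : Localization S →ₗ[R] A, ∀ s, φ (Localization.mk 1 s) ∈ C s := by
  classical
  have := h.isTopologicalAddGroup
  have := h.t2Space
  have := h.isLinearTopology
  have := IsLinearTopology.continuousConstSMul R A
  let D : S → S → Set (S → A) := fun s t => {a | a s ∈ C s ∧ (t : R) • a (s * t) = a s}
  have hfip : ∀ T : Set (S × S), T.Finite → (⋂ x ∈ T, D x.1 x.2).Nonempty := by
    intro T hT
    -- All elements that occur divide `u`, and everything is pushed down from one `b ∈ C (u * u)`.
    -- The extra factor `u` replaces cancellation: from `u = s * c = s * t * c'` one cannot deduce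
    -- `t * c' = c`, but `t * (u * c') = u * c` does hold.
    let u : S := ∏ x ∈ hT.toFinset, x.1 * x.2
    obtain ⟨b, hb⟩ := (hC (u * u)).nonempty
    have hdvd : ∀ x ∈ T, x.1 * x.2 ∣ u := fun x hx =>
      Finset.dvd_prod_of_mem (fun x : S × S => x.1 * x.2) (hT.mem_toFinset.mpr hx)
    let a : S → A := fun s => if hs : s ∣ u then ((u * hs.choose : S) : R) • b else 0
    have ha : ∀ s (hs : s ∣ u), a s = ((u * hs.choose : S) : R) • b := fun s hs => dif_pos hs
    refine ⟨a, Set.mem_iInter₂.mpr fun x hx => ?_⟩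
    have hst := hdvd x hx
    have hs := (dvd_mul_right _ _).trans hst
    refine ⟨?_, ?_⟩
    · rw [ha _ hs]
      refine hmul _ _ b ?_
      rwa [mul_left_comm, ← hs.choose_spec]
    · rw [ha _ hs, ha _ hst, smul_smul, ← Submonoid.coe_mul]
      congr 2
      calc x.2 * (u * hst.choose) = x.2 * (x.1 * hs.choose * hst.choose) := by
            rw [← hs.choose_spec]
        _ = hs.choose * (x.1 * x.2 * hst.choose) := by ac_rfl
        _ = u * hs.choose := by rw [← hst.choose_spec, mul_comm]
  obtain ⟨a, ha⟩ := (pi fun _ : S => h).sInter_nonempty (Set.range fun x : S × S => D x.1 x.2) (by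
      rintro _ ⟨⟨s, t⟩, rfl⟩
      obtain ⟨a, ha⟩ := hfip {(s, t)} (Set.finite_singleton _)
      have ha : a ∈ D s t := by simpa using ha
      obtain ⟨N, hN, hCN⟩ := (hC s).exists_submodule
      refine isClosedCoset_of_mem (m := a) (N := N.comap (LinearMap.proj s) ⊓
        LinearMap.ker ((t : R) • LinearMap.proj (s * t) - LinearMap.proj s : (S → A) →ₗ[R] A))
        ?_ fun y => ?_
      · exact (hN.preimage (continuous_apply s)).inter (LinearMap.isClosed_ker_of_continuous
          (((continuous_apply (s * t)).const_smul (t : R)).sub (continuous_apply s)))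
      · simp only [D, Set.mem_ofPred_eq, hCN _ ha.1 (y s), Submodule.mem_inf, Submodule.mem_comap,
          LinearMap.proj_apply, Pi.sub_apply, LinearMap.mem_ker, LinearMap.sub_apply,
          LinearMap.smul_apply, smul_sub, ha.2]
        refine and_congr_right fun _ => ?_
        rw [← sub_eq_zero, sub_sub_sub_cancel_right]) (by
      intro G hG hfin
      obtain ⟨T, -, hT, rfl⟩ := Set.exists_subset_image_finite_and (p := (G = ·))
        (s := Set.univ) (f := fun x : S × S => D x.1 x.2).mp
          ⟨G, by rwa [Set.image_univ], hfin, rfl⟩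
      rw [Set.sInter_image]
      exact hfip T hT)
  have ha' : ∀ s t, a ∈ D s t := fun s t => ha _ ⟨(s, t), rfl⟩
  obtain ⟨φ, hφ⟩ := exists_localization_hom S a fun s t => (ha' s t).2
  exact ⟨φ, fun s => hφ s ▸ (ha' s 1).1⟩

/-- `Hom_R(S⁻¹R, -)` is right exact on linearly compact modules. -/
theorem exists_mkQ_comp_eq (h : IsLinearlyCompactModule R A) (S : Submonoid R)
    {K : Submodule R A} (hK : IsClosed (K : Set A)) (φ : Localization S →ₗ[R] A ⧸ K) :
    ∃ ψ : Localization S →ₗ[R] A, K.mkQ ∘ₗ ψ = φ := by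
  obtain ⟨ψ, hψ⟩ := h.exists_hom_forall_mem S (fun s => {a | K.mkQ a = φ (Localization.mk 1 s)})
    (fun s => by
      obtain ⟨m, hm⟩ := K.mkQ_surjective (φ (Localization.mk 1 s))
      exact isClosedCoset_of_mem (m := m) hK fun y => by
        rw [Set.mem_ofPred_eq, ← hm, ← sub_eq_zero, ← map_sub, Submodule.mkQ_apply,
          Submodule.Quotient.mk_eq_zero])
    (fun s t a ha => by
      rw [Set.mem_ofPred_eq] at ha ⊢
      rw [map_smul, ha, ← map_smul, Localization.smul_mk_one_mul])
  refine ⟨ψ, LinearMap.ext fun z => ?_⟩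
  induction z using Localization.induction_on with | _ z
  rw [← mul_one z.1, ← smul_eq_mul, ← Localization.smul_mk, map_smul, map_smul]
  exact congrArg _ (hψ z.2)

theorem exists_comp_eq_of_range_le (h : IsLinearlyCompactModule R A) (S : Submonoid R)
    {B : Type*} [AddCommGroup B] [Module R B] [TopologicalSpace B] [T1Space B] {f : A →ₗ[R] B}
    (hf : Continuous f) (φ : Localization S →ₗ[R] B) (hφ : ∀ z, φ z ∈ LinearMap.range f) :
    ∃ ψ : Localization S →ₗ[R] A, f ∘ₗ ψ = φ := by
  obtain ⟨ψ, hψ⟩ := h.exists_mkQ_comp_eq S (LinearMap.isClosed_ker_of_continuous hf)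
    (f.quotKerEquivRange.symm.toLinearMap ∘ₗ φ.codRestrict _ hφ)
  refine ⟨ψ, LinearMap.ext fun z => ?_⟩
  have := congrArg (fun y => ((f.quotKerEquivRange y : LinearMap.range f) : B))
    (LinearMap.congr_fun hψ z)
  simpa using this

theorem exists_hom_apply_one_eq (h : IsLinearlyCompactModule R A) (S : Submonoid R) {m : A}
    (hm : ∀ s ∈ S, ∃ a : A, s • a = m) : ∃ φ : Localization S →ₗ[R] A, φ 1 = m := by
  have := h.isTopologicalAddGroup
  have := h.t2Space
  have := h.isLinearTopology
  have := IsLinearTopology.continuousConstSMul R A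
  obtain ⟨φ, hφ⟩ := h.exists_hom_forall_mem S (fun s => {a | (s : R) • a = m})
    (fun s => by
      obtain ⟨a, ha⟩ := hm s s.2
      exact isClosedCoset_of_mem (m := a) (N := LinearMap.ker (LinearMap.lsmul R A (s : R)))
        (LinearMap.isClosed_ker_of_continuous (continuous_const_smul (s : R))) fun y => by
          rw [Set.mem_ofPred_eq, LinearMap.mem_ker, LinearMap.lsmul_apply, smul_sub, ha,
            sub_eq_zero])
    (fun s t a ha => by
      rw [Set.mem_ofPred_eq] at ha ⊢
      rw [← ha, Submonoid.coe_mul, mul_smul])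
  refine ⟨φ, ?_⟩
  have := hφ 1
  rwa [Set.mem_ofPred_eq, Submonoid.coe_one, one_smul, Localization.mk_one] at this

end IsLinearlyCompactModule

/-! ### Matrices on column vectors, finite free resolutions, homology -/

namespace Matrix

variable {R : Type*} [CommRing R] {l m n : Type*} [Fintype l] [Fintype m] [Fintype n]
  {M : Type*} [AddCommGroup M] [Module R M]

/-- The action of a matrix over `R` on column vectors with entries in an `R`-module. -/
def smulVecLin (M : Type*) [AddCommGroup M] [Module R M] (A : Matrix m n R) :
    (n → M) →ₗ[R] (m → M) :=
  LinearMap.pi fun i => ∑ j, A i j • LinearMap.proj j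

omit [Fintype m] in
theorem smulVecLin_apply (A : Matrix m n R) (z : n → M) (i : m) :
    A.smulVecLin M z i = ∑ j, A i j • z j := by
  simp [smulVecLin]

omit [Fintype l] in
theorem smulVecLin_mul (A : Matrix l m R) (B : Matrix m n R) (z : n → M) :
    (A * B).smulVecLin M z = A.smulVecLin M (B.smulVecLin M z) := by
  ext i
  simp only [smulVecLin_apply, Matrix.mul_apply, Finset.sum_smul, Finset.smul_sum, smul_smul]
  exact Finset.sum_comm

omit [Fintype m] in
theorem smulVecLin_add (A B : Matrix m n R) (z : n → M) :
    (A + B).smulVecLin M z = A.smulVecLin M z + B.smulVecLin M z := by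
  ext i
  simp [smulVecLin_apply, add_smul, Finset.sum_add_distrib]

omit [Fintype m] in
theorem smulVecLin_zero (z : n → M) : (0 : Matrix m n R).smulVecLin M z = 0 := by
  ext i
  simp [smulVecLin_apply]

theorem smulVecLin_smul_one [DecidableEq n] (r : R) (z : n → M) :
    (r • (1 : Matrix n n R)).smulVecLin M z = r • z := by
  ext i
  simp [smulVecLin_apply, Matrix.one_apply]

omit [Fintype m] in
theorem smulVecLin_self (A : Matrix m n R) : A.smulVecLin R = A.mulVecLin := by
  ext z i
  simp [smulVecLin_apply, Matrix.mulVec, dotProduct]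

omit [Fintype m] in
theorem smulVecLin_mem (A : Matrix m n R) {K : Submodule R M} {z : n → M} (hz : ∀ j, z j ∈ K)
    (i : m) : A.smulVecLin M z i ∈ K := by
  rw [smulVecLin_apply]
  exact K.sum_mem fun j _ => K.smul_mem _ (hz j)

omit [Fintype m] in
theorem continuous_smulVecLin [TopologicalSpace M] [ContinuousAdd M] [ContinuousConstSMul R M]
    (A : Matrix m n R) : Continuous (A.smulVecLin M) := by
  refine continuous_pi fun i => ?_
  simp only [smulVecLin_apply]
  exact continuous_finsetSum _ fun j _ => (continuous_apply j).const_smul _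

end Matrix

/-- A resolution of an `R`-module by free modules of finite rank, given by matrices. -/
structure FiniteFreeResolution (R : Type*) [CommRing R] (N : Type*) [AddCommGroup N]
    [Module R N] where
  /-- the ranks of the free modules -/
  rank : ℕ → ℕ
  /-- the differentials -/
  d : ∀ i, Matrix (Fin (rank i)) (Fin (rank (i + 1))) R
  /-- the augmentation -/
  ε : (Fin (rank 0) → R) →ₗ[R] N
  surjective_ε : Function.Surjective ε
  range_d_zero : LinearMap.range (d 0).mulVecLin = LinearMap.ker ε
  range_d_succ : ∀ i, LinearMap.range (d (i + 1)).mulVecLin = LinearMap.ker (d i).mulVecLin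

namespace FiniteFreeResolution

variable {R : Type u} [CommRing R]

theorem exists_matrix_range_eq [IsNoetherianRing R] {n : ℕ} (K : Submodule R (Fin n → R)) :
    ∃ (m : ℕ) (A : Matrix (Fin n) (Fin m) R), LinearMap.range A.mulVecLin = K := by
  obtain ⟨m, f, hf⟩ := Module.Finite.exists_fin' R K
  refine ⟨m, LinearMap.toMatrix' (K.subtype ∘ₗ f), ?_⟩
  rw [← Matrix.toLin'_apply', Matrix.toLin'_toMatrix', LinearMap.range_comp,
    LinearMap.range_eq_top.mpr hf, Submodule.map_top, Submodule.range_subtype]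

theorem nonempty [IsNoetherianRing R] (N : Type*) [AddCommGroup N] [Module R N]
    [Module.Finite R N] : Nonempty (FiniteFreeResolution R N) := by
  obtain ⟨n, ε, hε⟩ := Module.Finite.exists_fin' R N
  choose r A hA using fun (n : ℕ) (K : Submodule R (Fin n → R)) => exists_matrix_range_eq K
  let s : ℕ → Σ a b : ℕ, Matrix (Fin a) (Fin b) R := fun i =>
    Nat.rec ⟨n, _, A n (LinearMap.ker ε)⟩
      (fun _ t => ⟨t.2.1, _, A _ (LinearMap.ker t.2.2.mulVecLin)⟩) i
  exact ⟨⟨fun i => (s i).1, fun i => (s i).2.2, ε, hε, hA _ _, fun i => hA _ _⟩⟩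

variable {N : Type*} [AddCommGroup N] [Module R N] (P : FiniteFreeResolution R N)

theorem d_mul_d (i : ℕ) : P.d i * P.d (i + 1) = 0 := by
  apply (Matrix.toLin' (R := R)).injective
  simp only [Matrix.toLin'_apply']
  rw [Matrix.mulVecLin_mul, Matrix.mulVecLin_zero]
  exact LinearMap.range_le_ker_iff.mp (P.range_d_succ i).le

variable (L : Type*) [AddCommGroup L] [Module R L]

/-- The cycles of the complex obtained from the resolution by tensoring with `L`. -/
def cycles : ∀ i, Submodule R (Fin (P.rank i) → L)
  | 0 => ⊤
  | i + 1 => LinearMap.ker ((P.d i).smulVecLin L)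

theorem d_mem_cycles (i : ℕ) (w : Fin (P.rank (i + 1)) → L) :
    (P.d i).smulVecLin L w ∈ P.cycles L i := by
  cases i with
  | zero => trivial
  | succ i =>
    rw [cycles, LinearMap.mem_ker, ← Matrix.smulVecLin_mul, d_mul_d, Matrix.smulVecLin_zero]

end FiniteFreeResolution

open CategoryTheory in
/-- Homomorphisms from `P` into the homology of a complex of modules vanish if and only if
`Hom(P, -)` of the complex is exact, provided homomorphisms from `P` can be lifted to the
terms of the complex. -/
theorem subsingleton_hom_homology_iff {R : Type u} [CommRing R] (S : ShortComplex (ModuleCat.{u} R))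
    {P : Type*} [AddCommGroup P] [Module R P]
    (hcoker : ∀ φ : P →ₗ[R] S.X₂ ⧸ LinearMap.range S.f.hom,
      ∃ ψ : P →ₗ[R] S.X₂, (LinearMap.range S.f.hom).mkQ ∘ₗ ψ = φ)
    (hrange : ∀ φ : P →ₗ[R] S.X₂, (∀ z, φ z ∈ LinearMap.range S.f.hom) →
      ∃ ψ : P →ₗ[R] S.X₁, S.f.hom ∘ₗ ψ = φ) :
    Subsingleton (P →ₗ[R] S.homology) ↔
      ∀ φ : P →ₗ[R] S.X₂, S.g.hom ∘ₗ φ = 0 → ∃ ψ : P →ₗ[R] S.X₁, S.f.hom ∘ₗ ψ = φ := by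
  let Q := LinearMap.range S.moduleCatToCycles
  let e : S.homology ≃ₗ[R] (LinearMap.ker S.g.hom ⧸ Q) := S.moduleCatHomologyIso.toLinearEquiv
  rw [(LinearEquiv.congrRight e : (P →ₗ[R] S.homology) ≃ₗ[R] _).toEquiv.subsingleton_congr]
  have hQ : Q = (LinearMap.range S.f.hom).comap (LinearMap.ker S.g.hom).subtype := by
    ext y
    constructor
    · rintro ⟨x, rfl⟩
      exact ⟨x, rfl⟩
    · rintro ⟨x, hx⟩
      exact ⟨x, Subtype.ext hx⟩
  constructor
  · intro h φ hφ
    refine hrange φ fun z => ?_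
    let φ' : P →ₗ[R] LinearMap.ker S.g.hom :=
      φ.codRestrict _ fun z => LinearMap.mem_ker.mpr (LinearMap.congr_fun hφ z)
    have h0 : Q.mkQ (φ' z) = 0 := by
      rw [← LinearMap.comp_apply, Subsingleton.elim (Q.mkQ ∘ₗ φ') 0, LinearMap.zero_apply]
    rw [Submodule.mkQ_apply, Submodule.Quotient.mk_eq_zero, hQ] at h0
    exact h0
  · intro h
    refine subsingleton_of_forall_eq 0 fun φ => ?_
    -- Homology embeds in the cokernel of `S.f`, where homomorphisms lift by `hcoker`; the lift
    -- automatically lands in the cycles.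
    let j : (LinearMap.ker S.g.hom ⧸ Q) →ₗ[R] S.X₂ ⧸ LinearMap.range S.f.hom :=
      Q.mapQ _ (LinearMap.ker S.g.hom).subtype hQ.le
    have hj : Function.Injective j := by
      rw [← LinearMap.ker_eq_bot, Submodule.ker_mapQ, ← hQ, Submodule.mkQ_map_self]
    obtain ⟨ψ, hψ⟩ := hcoker (j ∘ₗ φ)
    have hg : S.g.hom ∘ₗ ψ = 0 := by
      ext z
      obtain ⟨⟨y, hy⟩, hyz⟩ := Q.mkQ_surjective (φ z)
      have h1 := LinearMap.congr_fun hψ z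
      rw [LinearMap.comp_apply, LinearMap.comp_apply, ← hyz] at h1
      obtain ⟨x, hx⟩ := (Submodule.Quotient.eq _).mp h1
      have h2 : S.g.hom (ψ z - y) = 0 := by
        exact (congrArg S.g.hom hx.symm).trans (S.zero_apply x)
      rw [map_sub, LinearMap.mem_ker.mp hy, sub_zero] at h2
      exact h2
    obtain ⟨χ, hχ⟩ := h ψ hg
    ext z
    apply hj
    rw [← LinearMap.comp_apply, ← hψ, ← hχ]
    simp

theorem Matrix.smulVecLin_piScalarRight_tmul {R : Type*} [CommRing R] {m n : Type*} [Fintype m]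
    [DecidableEq m] [Fintype n] [DecidableEq n] {M : Type*} [AddCommGroup M] [Module R M]
    (A : Matrix m n R) (y : M) (x : n → R) :
    A.smulVecLin M (TensorProduct.piScalarRight R R M n (y ⊗ₜ x)) =
      TensorProduct.piScalarRight R R M m (y ⊗ₜ A.smulVecLin R x) := by
  ext k
  simp [Matrix.smulVecLin_apply, Finset.sum_smul, mul_smul]

/-! ### Tor computed by a finite free resolution -/

namespace FiniteFreeResolution

open CategoryTheory MonoidalCategory

variable {R : Type u} [CommRing R] {N : Type u} [AddCommGroup N] [Module R N]
  (P : FiniteFreeResolution R N) (M : Type u) [AddCommGroup M] [Module R M]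

/-- The complex obtained from the resolution by tensoring with `M`. -/
noncomputable def complex : ChainComplex (ModuleCat.{u} R) ℕ :=
  ChainComplex.of (fun i => ModuleCat.of R (Fin (P.rank i) → M))
    (fun i => ModuleCat.ofHom ((P.d i).smulVecLin M)) fun i => by
      rw [← ModuleCat.ofHom_comp, show (P.d i).smulVecLin M ∘ₗ (P.d (i + 1)).smulVecLin M = 0 from
        LinearMap.ext fun z => by
          rw [LinearMap.comp_apply, ← Matrix.smulVecLin_mul, d_mul_d, Matrix.smulVecLin_zero,
            LinearMap.zero_apply]]
      rfl

theorem complex_d (i : ℕ) :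
    (P.complex M).d (i + 1) i = ModuleCat.ofHom ((P.d i).smulVecLin M) := by
  simp [complex]

theorem hom_complex_d (i : ℕ) : ((P.complex R).d (i + 1) i).hom = (P.d i).mulVecLin :=
  (congrArg ModuleCat.Hom.hom (P.complex_d R i)).trans (P.d i).smulVecLin_self

/-- The projective resolution in `ModuleCat R`. -/
noncomputable def projectiveResolution : ProjectiveResolution (ModuleCat.of R N) where
  complex := P.complex R
  projective i := by
    change Projective (ModuleCat.of R (Fin (P.rank i) → R))
    infer_instance
  π := (ChainComplex.toSingle₀Equiv (P.complex R) (ModuleCat.of R N)).symm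
    ⟨ModuleCat.ofHom P.ε, by
      rw [complex_d, Matrix.smulVecLin_self]
      ext z : 2
      exact P.range_d_zero.le ⟨z, rfl⟩⟩
  quasiIso := ⟨fun n => by
    cases n with
    | zero =>
      rw [ChainComplex.quasiIsoAt₀_iff, ShortComplex.quasiIso_iff_of_zeros']
      · refine (ShortComplex.exact_and_epi_g_iff_of_iso
          (S₁ := ShortComplex.mk ((P.complex R).d 1 0) (X₃ := ModuleCat.of R N)
            (ModuleCat.ofHom P.ε) ?_) ?_).1 ⟨?_, ?_⟩
        · rw [complex_d, Matrix.smulVecLin_self]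
          ext z : 2
          exact P.range_d_zero.le ⟨z, rfl⟩
        · exact ShortComplex.isoMk (Iso.refl _) (Iso.refl _) (Iso.refl _)
            ((Category.id_comp _).trans (Category.comp_id _).symm)
            ((Category.id_comp _).trans ((ChainComplex.toSingle₀Equiv_symm_apply_f_zero _ _).trans
              (Category.comp_id _).symm))
        · rw [ShortComplex.moduleCat_exact_iff_range_eq_ker]
          exact (congrArg (fun f : (Fin (P.rank 1) → R) →ₗ[R] (Fin (P.rank 0) → R) =>
            LinearMap.range f) (P.hom_complex_d 0)).trans P.range_d_zero
        · exact (ModuleCat.epi_iff_surjective _).mpr P.surjective_ε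
      all_goals rfl
    | succ n =>
      rw [quasiIsoAt_iff_exactAt']
      · rw [HomologicalComplex.exactAt_iff' _ (n + 1 + 1) (n + 1) n (by simp) (by simp),
          ShortComplex.moduleCat_exact_iff_range_eq_ker]
        exact (congrArg (fun f : (Fin (P.rank (n + 2)) → R) →ₗ[R] (Fin (P.rank (n + 1)) → R) =>
          LinearMap.range f) (P.hom_complex_d (n + 1))).trans ((P.range_d_succ n).trans
            (congrArg (fun f : (Fin (P.rank (n + 1)) → R) →ₗ[R] (Fin (P.rank n) → R) =>
              LinearMap.ker f) (P.hom_complex_d n).symm))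
      · apply ChainComplex.exactAt_succ_single_obj⟩

/-- Tensoring the resolution with `M` gives the complex with terms `Mᵇ`. -/
noncomputable def tensorComplexIso :
    (((tensoringRight (ModuleCat.{u} R)).obj (ModuleCat.of R M)).mapHomologicalComplex _).obj
      (P.complex R) ≅ P.complex M :=
  HomologicalComplex.Hom.isoOfComponents
    (fun i => (TensorProduct.comm R (Fin (P.rank i) → R) M ≪≫ₗ
      TensorProduct.piScalarRight R R M (Fin (P.rank i))).toModuleIso) (by
    rintro i j (rfl : j + 1 = i)
    rw [complex_d]
    change _ = ((P.complex R).d (j + 1) j ▷ ModuleCat.of R M) ≫ _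
    rw [complex_d]
    refine ModuleCat.hom_ext (TensorProduct.ext' fun x m => ?_)
    exact (P.d j).smulVecLin_piScalarRight_tmul m x)

/-- `Tor` is computed by the resolution. -/
noncomputable def torIso (i : ℕ) : torModule R i N M ≅ (P.complex M).homology i :=
  P.projectiveResolution.isoLeftDerivedObj
    ((tensoringRight (ModuleCat.{u} R)).obj (ModuleCat.of R M)) i ≪≫
    (HomologicalComplex.homologyFunctor _ _ i).mapIso (P.tensorComplexIso M)

end FiniteFreeResolution

/-! ### Exactness of the resolution with coefficients in a submodule -/

theorem Matrix.exists_mul_eq_of_range_le {R : Type*} [CommRing R] {l m n : Type*} [Fintype m]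
    [Fintype n] [DecidableEq n] {A : Matrix l m R} {C : Matrix l n R}
    (h : LinearMap.range C.mulVecLin ≤ LinearMap.range A.mulVecLin) :
    ∃ H : Matrix m n R, A * H = C := by
  choose v hv using fun j : n => h ⟨Pi.single j 1, rfl⟩
  refine ⟨Matrix.of fun i j => v j i, ?_⟩
  ext i j
  have := congrFun (hv j) i
  simp only [Matrix.mulVecLin_apply, Matrix.mulVec_single_one] at this
  exact this

theorem Matrix.smulVecLin_comp_pi {R : Type*} [CommRing R] {m n : Type*} [Fintype n]
    {M P : Type*} [AddCommGroup M] [Module R M] [AddCommGroup P] [Module R P] (A : Matrix m n R)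
    (w : n → P →ₗ[R] M) :
    A.smulVecLin M ∘ₗ LinearMap.pi w = LinearMap.pi (A.smulVecLin (P →ₗ[R] M) w) := by
  ext y i
  simp [Matrix.smulVecLin_apply, LinearMap.sum_apply]

namespace FiniteFreeResolution

section Exactness

variable {R : Type*} [CommRing R] {N : Type*} [AddCommGroup N] [Module R N]
  (P : FiniteFreeResolution R N) {L : Type*} [AddCommGroup L] [Module R L]

/-- The complex obtained by tensoring the resolution with the submodule `K` is exact at `i`. -/
def ExactAt (K : Submodule R L) (i : ℕ) : Prop :=
  ∀ z ∈ P.cycles L i, (∀ j, z j ∈ K) → ∃ w, (∀ j, w j ∈ K) ∧ (P.d i).smulVecLin L w = z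

/-- Multiplication by `y` is zero on `N`, hence null-homotopic on the resolution; `H` is a component
of the homotopy. In the inductive step `y - G * d i` is killed by `d i`, so it factors through `d (i
+ 1)`. -/
theorem exists_d_mul_mul_d {y : R} (hy : ∀ n : N, y • n = 0) (i : ℕ) :
    ∃ H : Matrix (Fin (P.rank (i + 1))) (Fin (P.rank i)) R, P.d i * H * P.d i = y • P.d i := by
  induction i with
  | zero =>
    obtain ⟨H, hH⟩ := Matrix.exists_mul_eq_of_range_le (A := P.d 0)
      (C := y • (1 : Matrix (Fin (P.rank 0)) (Fin (P.rank 0)) R)) (by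
      rw [P.range_d_zero]
      rintro _ ⟨v, rfl⟩
      simp [hy])
    exact ⟨H, by rw [hH, Matrix.smul_mul, Matrix.one_mul]⟩
  | succ i ih =>
    obtain ⟨G, hG⟩ := ih
    obtain ⟨H, hH⟩ := Matrix.exists_mul_eq_of_range_le (A := P.d (i + 1))
      (C := y • (1 : Matrix (Fin (P.rank (i + 1))) (Fin (P.rank (i + 1))) R) - G * P.d i)
      (by
        rw [P.range_d_succ]
        rintro _ ⟨v, rfl⟩
        rw [LinearMap.mem_ker, ← LinearMap.comp_apply, ← Matrix.mulVecLin_mul, Matrix.mul_sub,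
          ← Matrix.mul_assoc, hG]
        simp)
    exact ⟨H, by rw [hH, Matrix.sub_mul, Matrix.mul_assoc, d_mul_d]; simp⟩

/-- The null-homotopy, applied with coefficients in `K`, shows that `y` kills the homology. -/
theorem exists_d_eq_smul {y : R} (hy : ∀ n : N, y • n = 0) {K : Submodule R L} {i : ℕ}
    {z : Fin (P.rank i) → L} (hz : z ∈ P.cycles L i) (hzK : ∀ j, z j ∈ K) :
    ∃ w, (∀ j, w j ∈ K) ∧ (P.d i).smulVecLin L w = y • z := by
  cases i with
  | zero =>
    obtain ⟨H, hH⟩ := Matrix.exists_mul_eq_of_range_le (A := P.d 0)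
      (C := y • (1 : Matrix (Fin (P.rank 0)) (Fin (P.rank 0)) R)) (by
      rw [P.range_d_zero]
      rintro _ ⟨v, rfl⟩
      simp [hy])
    exact ⟨H.smulVecLin L z, H.smulVecLin_mem hzK, by
      rw [← Matrix.smulVecLin_mul, hH, Matrix.smulVecLin_smul_one]⟩
  | succ i =>
    obtain ⟨G, hG⟩ := P.exists_d_mul_mul_d hy i
    obtain ⟨H, hH⟩ := Matrix.exists_mul_eq_of_range_le (A := P.d (i + 1))
      (C := y • (1 : Matrix (Fin (P.rank (i + 1))) (Fin (P.rank (i + 1))) R) - G * P.d i)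
      (by
        rw [P.range_d_succ]
        rintro _ ⟨v, rfl⟩
        rw [LinearMap.mem_ker, ← LinearMap.comp_apply, ← Matrix.mulVecLin_mul, Matrix.mul_sub,
          ← Matrix.mul_assoc, hG]
        simp)
    refine ⟨H.smulVecLin L z, H.smulVecLin_mem hzK, ?_⟩
    rw [cycles, LinearMap.mem_ker] at hz
    rw [← Matrix.smulVecLin_mul, hH, sub_eq_add_neg, Matrix.smulVecLin_add,
      Matrix.smulVecLin_smul_one, ← Matrix.neg_mul, Matrix.smulVecLin_mul, hz, map_zero, add_zero]

/-- The obstruction to dividing a cycle by `x` is its connecting image in the homology of `(0 :_K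
x)` one degree lower. -/
theorem exists_cycle_smul_eq {x : R} {K : Submodule R L} (hx : ∀ l ∈ K, ∃ l' ∈ K, x • l' = l)
    {i : ℕ} (h : ∀ j, i = j + 1 → P.ExactAt (K ⊓ LinearMap.ker (LinearMap.lsmul R L x)) j)
    {z : Fin (P.rank i) → L} (hz : z ∈ P.cycles L i) (hzK : ∀ j, z j ∈ K) :
    ∃ z' ∈ P.cycles L i, (∀ j, z' j ∈ K) ∧ x • z' = z := by
  choose y hyK hy using fun j => hx _ (hzK j)
  have hxy : x • y = z := funext hy
  cases i with
  | zero => exact ⟨y, trivial, hyK, hxy⟩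
  | succ i =>
    rw [cycles, LinearMap.mem_ker] at hz
    obtain ⟨w, hwK, hw⟩ := h i rfl ((P.d i).smulVecLin L y) (P.d_mem_cycles L i y) fun j =>
      ⟨(P.d i).smulVecLin_mem hyK j, by
        have : x • (P.d i).smulVecLin L y = 0 := by rw [← map_smul, hxy, hz]
        exact congrFun this j⟩
    refine ⟨y - w, ?_, fun j => K.sub_mem (hyK j) (hwK j).1, ?_⟩
    · rw [cycles, LinearMap.mem_ker, map_sub, hw, sub_self]
    · rw [smul_sub, hxy, sub_eq_self]
      exact funext fun j => (hwK j).2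

/-- Every cycle is `x ^ k` times a cycle, and `x ^ k` kills homology. -/
theorem exactAt_of_forall_exists_smul_eq {x : R} {k : ℕ} (hN : ∀ n : N, x ^ k • n = 0)
    {K : Submodule R L} (hx : ∀ l ∈ K, ∃ l' ∈ K, x • l' = l) {i : ℕ}
    (h : ∀ j, i = j + 1 → P.ExactAt (K ⊓ LinearMap.ker (LinearMap.lsmul R L x)) j) :
    P.ExactAt K i := by
  intro z hz hzK
  have hdiv : ∀ m : ℕ, ∃ z' ∈ P.cycles L i, (∀ j, z' j ∈ K) ∧ x ^ m • z' = z := by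
    intro m
    induction m with
    | zero => exact ⟨z, hz, hzK, by simp⟩
    | succ m ih =>
      obtain ⟨z', hz', hzK', rfl⟩ := ih
      obtain ⟨z'', hz'', hzK'', rfl⟩ := P.exists_cycle_smul_eq hx h hz' hzK'
      exact ⟨z'', hz'', hzK'', by rw [pow_succ, mul_smul]⟩
  obtain ⟨z', hz', hzK', rfl⟩ := hdiv k
  exact P.exists_d_eq_smul hN hz' hzK'

/-- This is the segment `H_{i+1}(K) → H_i(0 :_K x) → H_i(K)` of the long exact sequence, as a
diagram chase. -/
theorem ExactAt.inf_ker {x : R} {K : Submodule R L} (hx : ∀ l ∈ K, ∃ l' ∈ K, x • l' = l) {i : ℕ}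
    (h : P.ExactAt K i) (h' : P.ExactAt K (i + 1)) :
    P.ExactAt (K ⊓ LinearMap.ker (LinearMap.lsmul R L x)) i := by
  intro z hz hzK
  have hxz : x • z = 0 := funext fun j => (hzK j).2
  obtain ⟨w, hwK, rfl⟩ := h z hz fun j => (hzK j).1
  obtain ⟨v, hvK, hv⟩ := h' (x • w) (by rw [cycles, LinearMap.mem_ker, map_smul, hxz])
    fun j => K.smul_mem _ (hwK j)
  choose v' hvK' hv' using fun j => hx _ (hvK j)
  have hxv : x • v' = v := funext hv'
  refine ⟨w - (P.d (i + 1)).smulVecLin L v', fun j => ⟨K.sub_mem (hwK j)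
    ((P.d (i + 1)).smulVecLin_mem hvK' j), ?_⟩, ?_⟩
  · have : x • (w - (P.d (i + 1)).smulVecLin L v') = 0 := by
      rw [smul_sub, ← map_smul, hxv, hv, sub_self]
    exact congrFun this j
  · rw [map_sub, ← Matrix.smulVecLin_mul, d_mul_d, Matrix.smulVecLin_zero, sub_zero]

/-- Exactness in degree zero for a resolution of `R ⧸ I` says `K = I K`. -/
theorem ExactAt.le_smul {I : Ideal R} (P : FiniteFreeResolution R (R ⧸ I)) {K : Submodule R L}
    (h : P.ExactAt K 0) : K ≤ I • K := by
  intro l hl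
  -- `C` lifts the augmentation to a row over `R`, and `e` lifts `1`. Writing `e ⊗ l` as a boundary
  -- and applying `C` gives `(C e) l ∈ I K`, because `C * d 0` has entries in `I`; and `C e ≡ 1`
  -- modulo `I`.
  obtain ⟨e, he⟩ := P.surjective_ε 1
  choose c hc using fun j => I.mkQ_surjective (P.ε (Pi.single j 1))
  let C : Matrix (Fin 1) (Fin (P.rank 0)) R := Matrix.of fun _ j => c j
  have hε : ∀ v : Fin (P.rank 0) → R, I.mkQ (C.smulVecLin R v 0) = P.ε v := by
    have : I.mkQ ∘ₗ LinearMap.proj 0 ∘ₗ C.smulVecLin R = P.ε := by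
      refine LinearMap.pi_ext' fun j => LinearMap.ext_ring ?_
      change I.mkQ (C.smulVecLin R (Pi.single j 1) 0) = P.ε (Pi.single j 1)
      rw [← hc j, Matrix.smulVecLin_self, Matrix.mulVecLin_apply, Matrix.mulVec_single_one]
      rfl
    exact LinearMap.congr_fun this
  have hCd : ∀ j, (C * P.d 0) 0 j ∈ I := by
    intro j
    have h0 : P.ε ((P.d 0).mulVecLin (Pi.single j 1)) = 0 :=
      LinearMap.mem_ker.mp (P.range_d_zero.le ⟨_, rfl⟩)
    rw [← hε, ← Matrix.smulVecLin_self, ← Matrix.smulVecLin_mul, Matrix.smulVecLin_self] at h0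
    rw [Matrix.mulVecLin_apply, Matrix.mulVec_single_one] at h0
    exact (Submodule.Quotient.mk_eq_zero I).mp h0
  obtain ⟨w, hwK, hw⟩ := h (fun j => e j • l) trivial fun j => K.smul_mem _ hl
  have h1 : C.smulVecLin R e 0 - 1 ∈ I := by
    rw [← Submodule.Quotient.mk_eq_zero, Submodule.Quotient.mk_sub, ← Submodule.mkQ_apply, hε, he]
    exact sub_self _
  have h2 : C.smulVecLin R e 0 • l ∈ I • K := by
    have : C.smulVecLin R e 0 • l = (C * P.d 0).smulVecLin L w 0 := by
      rw [Matrix.smulVecLin_mul, hw]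
      simp [Matrix.smulVecLin_apply, Finset.sum_smul, mul_smul]
    rw [this, Matrix.smulVecLin_apply]
    exact Submodule.sum_mem _ fun j _ => Submodule.smul_mem_smul (hCd j) (hwK j)
  have h3 := Submodule.sub_mem _ h2 (Submodule.smul_mem_smul h1 hl)
  rwa [sub_smul, one_smul, sub_sub_cancel] at h3

end Exactness

/-! ### The co-support of Tor -/

section Tor

open CategoryTheory

variable {R : Type u} [CommRing R] {N : Type u} [AddCommGroup N] [Module R N]
  (P : FiniteFreeResolution R N) (M : Type u) [AddCommGroup M] [Module R M] [TopologicalSpace M]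

/-- The differential out of degree `i`, which is zero for `i = 0`. -/
def dFrom (M : Type*) [AddCommGroup M] [Module R M] :
    ∀ i, (Fin (P.rank i) → M) →ₗ[R] (Fin (P.rank (i - 1)) → M)
  | 0 => 0
  | i + 1 => (P.d i).smulVecLin M

omit [TopologicalSpace M] in
theorem dFrom_comp_d (i : ℕ) : P.dFrom M i ∘ₗ (P.d i).smulVecLin M = 0 := by
  cases i with
  | zero => exact LinearMap.zero_comp _
  | succ i => exact LinearMap.ext fun w => P.d_mem_cycles M (i + 1) w

omit [TopologicalSpace M] in
theorem complex_d_pred (i : ℕ) : (P.complex M).d i (i - 1) = ModuleCat.ofHom (P.dFrom M i) := by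
  cases i with
  | zero => exact (P.complex M).shape _ _ (by simp)
  | succ i => exact P.complex_d M i

omit [TopologicalSpace M] in
theorem dFrom_comp_pi_eq_zero_iff {L : Type*} [AddCommGroup L] [Module R L] {i : ℕ}
    (z : Fin (P.rank i) → (L →ₗ[R] M)) :
    P.dFrom M i ∘ₗ LinearMap.pi z = 0 ↔ z ∈ P.cycles (L →ₗ[R] M) i := by
  cases i with
  | zero => exact ⟨fun _ => trivial, fun _ => LinearMap.zero_comp _⟩
  | succ i =>
    rw [cycles, LinearMap.mem_ker, dFrom, Matrix.smulVecLin_comp_pi]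
    exact ⟨fun h => funext fun j => congrArg (LinearMap.proj j ∘ₗ ·) h, fun h => h ▸ rfl⟩

/-- The bridge from Tor to algebra: the terms `M^b` are linearly compact and the differentials are
continuous with closed range, so `Hom(R_p, -)` commutes with homology as far as vanishing is
concerned. -/
theorem notMem_coSupport_torModule_iff (hM : IsLinearlyCompactModule R M) (i : ℕ)
    (p : PrimeSpectrum R) : p ∉ coSupport R (torModule R i N M) ↔
      P.ExactAt (⊤ : Submodule R (Localization.AtPrime p.asIdeal →ₗ[R] M)) i := by
  have := hM.isTopologicalAddGroup
  have := hM.t2Space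
  have := hM.isLinearTopology
  have := IsLinearTopology.continuousConstSMul R M
  let S : ShortComplex (ModuleCat.{u} R) := ShortComplex.mk
    (ModuleCat.ofHom ((P.d i).smulVecLin M)) (ModuleCat.ofHom (P.dFrom M i))
    (ModuleCat.hom_ext (P.dFrom_comp_d M i))
  have hS : torModule R i N M ≅ S.homology := P.torIso M i ≪≫ ShortComplex.homologyMapIso
    ((P.complex M).isoSc' (i + 1) i (i - 1) (by simp) (by cases i <;> simp) ≪≫
      (ShortComplex.isoMk (Iso.refl _) (Iso.refl _) (Iso.refl _)
        ((Category.id_comp _).trans ((P.complex_d M i).symm.trans (Category.comp_id _).symm))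
        ((Category.id_comp _).trans ((P.complex_d_pred M i).symm.trans (Category.comp_id _).symm)) :
          (P.complex M).sc' (i + 1) i (i - 1) ≅ S))
  have hpi := fun k => IsLinearlyCompactModule.pi fun _ : Fin (P.rank k) => hM
  have hcont := (P.d i).continuous_smulVecLin (M := M)
  have key := subsingleton_hom_homology_iff S
    (P := Localization p.asIdeal.primeCompl)
    (fun φ => (hpi i).exists_mkQ_comp_eq p.asIdeal.primeCompl
      ((hpi (i + 1)).isClosed_range hcont) φ)
    (fun φ hφ => (hpi (i + 1)).exists_comp_eq_of_range_le p.asIdeal.primeCompl hcont φ hφ)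
  have key' : Subsingleton (Localization p.asIdeal.primeCompl →ₗ[R] S.homology) ↔
      ∀ φ : Localization p.asIdeal.primeCompl →ₗ[R] (Fin (P.rank i) → M), P.dFrom M i ∘ₗ φ = 0 →
        ∃ ψ : Localization p.asIdeal.primeCompl →ₗ[R] (Fin (P.rank (i + 1)) → M),
          (P.d i).smulVecLin M ∘ₗ ψ = φ := key
  change ¬ Nontrivial (Localization.AtPrime p.asIdeal →ₗ[R] torModule R i N M) ↔ _
  rw [not_nontrivial_iff_subsingleton, (LinearEquiv.congrRight hS.toLinearEquiv :
    (Localization.AtPrime p.asIdeal →ₗ[R] torModule R i N M) ≃ₗ[R] _).toEquiv.subsingleton_congr]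
  refine key'.trans ⟨fun h z hz _ => ?_, fun h φ hφ => ?_⟩
  · obtain ⟨ψ, hψ⟩ := h (LinearMap.pi z) ((P.dFrom_comp_pi_eq_zero_iff M z).mpr hz)
    refine ⟨fun j => LinearMap.proj j ∘ₗ ψ, fun _ => trivial, funext fun j => ?_⟩
    have := Matrix.smulVecLin_comp_pi (P.d i) fun j => LinearMap.proj j ∘ₗ ψ
    rw [show (LinearMap.pi fun j => LinearMap.proj j ∘ₗ ψ) = ψ from rfl, hψ] at this
    exact (congrArg (LinearMap.proj j ∘ₗ ·) this).symm
  · obtain ⟨w, -, hw⟩ := h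
      (fun j => (LinearMap.proj j : (Fin (P.rank i) → M) →ₗ[R] M) ∘ₗ φ)
      ((P.dFrom_comp_pi_eq_zero_iff M _).mp hφ) fun _ => trivial
    refine ⟨LinearMap.pi w, ?_⟩
    rw [Matrix.smulVecLin_comp_pi, hw]
    rfl

end Tor

end FiniteFreeResolution

/-! ### Secondary representations and the choice of a co-regular element -/

section Secondary

variable {R : Type*} [CommRing R] {A : Type*} [AddCommGroup A] [Module R A] {N : Submodule R A}

theorem Submodule.mem_radical_annihilator_iff {a : R} :
    a ∈ N.annihilator.radical ↔ ∃ k : ℕ, ∀ m ∈ N, a ^ k • m = 0 := by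
  simp only [Ideal.mem_radical_iff, Submodule.mem_annihilator]

theorem IsSecondaryModule.exists_smul_eq (h : IsSecondaryModule R N) {a : R}
    (ha : a ∉ N.annihilator.radical) {m : A} (hm : m ∈ N) : ∃ m' ∈ N, a • m' = m := by
  rcases h.2 a with hs | ⟨k, hk⟩
  · obtain ⟨m', hm'⟩ := hs ⟨m, hm⟩
    exact ⟨m', m'.2, congrArg Subtype.val hm'⟩
  · exact absurd (Submodule.mem_radical_annihilator_iff.mpr
      ⟨k, fun m hm => congrArg Subtype.val (hk ⟨m, hm⟩)⟩) ha

theorem IsSecondaryModule.isPrime_radical_annihilator (h : IsSecondaryModule R N) :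
    N.annihilator.radical.IsPrime := by
  refine Ideal.isPrime_iff.mpr
    ⟨fun htop => ?_, fun {a b} hab => or_iff_not_imp_left.mpr fun ha => ?_⟩
  · obtain ⟨k, hk⟩ := Submodule.mem_radical_annihilator_iff.mp ((Ideal.eq_top_iff_one _).mp htop)
    obtain ⟨m, hm⟩ := @exists_ne _ h.1 0
    refine hm (Subtype.ext ?_)
    simpa using hk m m.2
  · obtain ⟨k, hk⟩ := Submodule.mem_radical_annihilator_iff.mp hab
    have hdiv : ∀ (j : ℕ), ∀ m ∈ N, ∃ m' ∈ N, a ^ j • m' = m := by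
      intro j
      induction j with
      | zero => exact fun m hm => ⟨m, hm, by simp⟩
      | succ j ih =>
        intro m hm
        obtain ⟨m', hm', rfl⟩ := ih m hm
        obtain ⟨m'', hm'', rfl⟩ := h.exists_smul_eq ha hm'
        exact ⟨m'', hm'', by rw [pow_succ, mul_smul]⟩
    refine Submodule.mem_radical_annihilator_iff.mpr ⟨k, fun m hm => ?_⟩
    obtain ⟨m', hm', rfl⟩ := hdiv k m hm
    rw [smul_smul, ← mul_pow, mul_comm b a]
    exact hk m' hm'

/-- A representable module has an irredundant secondary representation. -/
theorem IsRepresentableModule.exists_irredundant (h : IsRepresentableModule R A) :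
    ∃ s : Finset (Submodule R A), (∀ N ∈ s, IsSecondaryModule R N) ∧ s.sup id = ⊤ ∧
      ∀ N ∈ s, ∃ B : Submodule R A, N ⊔ B = ⊤ ∧ ¬ N ≤ B := by
  classical
  obtain ⟨s, hs⟩ := exists_minimal_of_wellFoundedLT
    (fun s : Finset (Submodule R A) => (∀ N ∈ s, IsSecondaryModule R N) ∧ s.sup id = ⊤) h
  refine ⟨s, hs.prop.1, hs.prop.2, fun N hN => ⟨(s.erase N).sup id, ?_, fun hle => ?_⟩⟩
  · rw [← hs.prop.2, ← Finset.insert_erase hN, Finset.sup_insert, Finset.insert_erase hN, id]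
  · refine hs.not_prop_of_lt (Finset.erase_ssubset hN)
      ⟨fun K hK => hs.prop.1 K (Finset.mem_of_mem_erase hK), ?_⟩
    rw [← sup_eq_right.mpr hle, ← hs.prop.2]
    conv_rhs => rw [← Finset.insert_erase hN, Finset.sup_insert]
    rfl

/-- Since `u` is invertible on `R_p`, homomorphisms from `R_p` do not see the components that `u`
kills. -/
theorem exists_mem_primeCompl_smul_eq_zero (s : Finset (Submodule R A)) (p : Ideal R) [p.IsPrime] :
    ∃ u ∈ p.primeCompl, ∀ N ∈ s, ¬ N.annihilator.radical ≤ p → ∀ m ∈ N, u • m = 0 := by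
  classical
  have h : ∀ N : Submodule R A, ∃ u ∈ p.primeCompl, ¬ N.annihilator.radical ≤ p →
      ∀ m ∈ N, u • m = 0 := by
    intro N
    by_cases hN : N.annihilator.radical ≤ p
    · exact ⟨1, one_mem _, fun h => absurd hN h⟩
    · obtain ⟨a, ha, hap⟩ := SetLike.not_le_iff_exists.mp hN
      obtain ⟨k, hk⟩ := Submodule.mem_radical_annihilator_iff.mp ha
      exact ⟨a ^ k, pow_mem (show a ∈ p.primeCompl from hap) k, fun _ => hk⟩
  choose u hu hu0 using h
  refine ⟨∏ N ∈ s, u N, prod_mem fun N _ => hu N, fun N hN hNp m hm => ?_⟩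
  rw [← Finset.prod_erase_mul _ _ hN, mul_smul, hu0 N hNp m hm, smul_zero]

end Secondary

namespace IsLinearlyCompactModule

variable {R : Type*} [CommRing R] {A : Type*} [AddCommGroup A] [Module R A] [TopologicalSpace A]

theorem notMem_coSupport_quotient_range_lsmul_iff (hA : IsLinearlyCompactModule R A) (x : R)
    (p : PrimeSpectrum R) :
    p ∉ coSupport R (A ⧸ LinearMap.range (LinearMap.lsmul R A x)) ↔
      ∀ φ : Localization.AtPrime p.asIdeal →ₗ[R] A, ∃ ψ, x • ψ = φ := by
  have := hA.isTopologicalAddGroup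
  have := hA.t2Space
  have := hA.isLinearTopology
  have := IsLinearTopology.continuousConstSMul R A
  have hx : Continuous (LinearMap.lsmul R A x) := continuous_const_smul x
  change ¬ Nontrivial _ ↔ _
  rw [not_nontrivial_iff_subsingleton]
  constructor
  · intro h φ
    refine hA.exists_comp_eq_of_range_le p.asIdeal.primeCompl hx φ fun z => ?_
    rw [← Submodule.Quotient.mk_eq_zero, ← Submodule.mkQ_apply, ← LinearMap.comp_apply,
      Subsingleton.elim (Submodule.mkQ _ ∘ₗ φ) 0, LinearMap.zero_apply]
  · intro h
    refine subsingleton_of_forall_eq 0 fun ξ => ?_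
    obtain ⟨φ, rfl⟩ := hA.exists_mkQ_comp_eq p.asIdeal.primeCompl (hA.isClosed_range hx) ξ
    obtain ⟨ψ, rfl⟩ := h φ
    refine LinearMap.ext fun z => (Submodule.Quotient.mk_eq_zero _).mpr ⟨ψ z, rfl⟩

/-- If evaluation at `1` of the homomorphisms `R_p → A` lands in every `I ^ k A` for `p ∉ X`, then
some element of `I` acts surjectively on all these `Hom_R(R_p, A)`. -/
theorem exists_mem_forall_exists_smul_eq (hA : IsLinearlyCompactModule R A)
    (hrep : IsRepresentableModule R A) {X : Set (PrimeSpectrum R)} (hX : IsSaturatedSubset X)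
    {I : Ideal R} (hI : I.FG)
    (h : ∀ p ∉ X, ∀ φ : Localization.AtPrime p.asIdeal →ₗ[R] A, ∀ k : ℕ,
      φ 1 ∈ I ^ k • (⊤ : Submodule R A)) :
    ∃ x ∈ I, ∀ p ∉ X, ∀ φ : Localization.AtPrime p.asIdeal →ₗ[R] A, ∃ ψ, x • ψ = φ := by
  classical
  have := hA.isTopologicalAddGroup
  have := hA.t2Space
  have := hA.isLinearTopology
  have := IsLinearTopology.continuousConstSMul R A
  obtain ⟨s, hsec, htop, hirr⟩ := hrep.exists_irredundant
  -- The components whose prime lies outside `X`; only these constrain `x`.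
  let t := s.filter fun N => ∀ q ∈ X, q.asIdeal ≠ N.annihilator.radical
  -- If `I` lies in the prime `p` of `N`, then `I ^ k` kills `N` for some `k`. Elements outside `p`
  -- act surjectively on `N`, so every `m ∈ N` is the value at `1` of a homomorphism from `R_p`.
  -- Hence `m ∈ I ^ k (N + B) ⊆ B`, contradicting irredundancy.
  have hI' : ∀ N ∈ t, ¬ I ≤ N.annihilator.radical := by
    intro N hN hle
    obtain ⟨hNs, hNX⟩ := Finset.mem_filter.mp hN
    obtain ⟨B, hB, hNB⟩ := hirr N hNs
    refine hNB fun m hm => ?_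
    obtain ⟨k, hk⟩ := Ideal.exists_pow_le_of_le_radical_of_fg hle hI
    let p : PrimeSpectrum R := ⟨_, (hsec N hNs).isPrime_radical_annihilator⟩
    have := p.isPrime
    obtain ⟨φ, rfl⟩ := hA.exists_hom_apply_one_eq p.asIdeal.primeCompl (m := m) fun u hu =>
      ((hsec N hNs).exists_smul_eq hu hm).imp fun _ h => h.2
    have hφ := h p (fun hp => hNX p hp rfl) φ k
    rw [← hB, Submodule.smul_sup] at hφ
    refine (sup_le ?_ Submodule.smul_le_right : I ^ k • N ⊔ I ^ k • B ≤ B) hφ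
    refine Submodule.smul_le.mpr fun r hr n hn => ?_
    rw [Submodule.mem_annihilator.mp (hk hr) n hn]
    exact B.zero_mem
  obtain ⟨x, hxI, hx⟩ : ∃ x ∈ I, ∀ N ∈ t, x ∉ N.annihilator.radical := by
    by_contra! hcon
    -- The two `⊥` are dummies: they fill the indices at which prime avoidance would allow non-prime
    -- ideals.
    obtain ⟨N, hN, hle⟩ := (Ideal.subset_union_prime (s := t)
      (f := fun N => N.annihilator.radical) ⊥ ⊥ fun N hN _ _ =>
        (hsec N (Finset.mem_filter.mp hN).1).isPrime_radical_annihilator).mp fun x hx => by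
          obtain ⟨N, hN, hxN⟩ := hcon x hx
          exact Set.mem_biUnion hN hxN
    exact hI' N hN hle
  refine ⟨x, hxI, fun p hp φ => ?_⟩
  have hxc : Continuous (LinearMap.lsmul R A x) := continuous_const_smul x
  refine hA.exists_comp_eq_of_range_le p.asIdeal.primeCompl hxc φ fun z => ?_
  obtain ⟨u, hu, hu0⟩ := exists_mem_primeCompl_smul_eq_zero s p.asIdeal
  have hle : s.sup id ≤
      (LinearMap.range (LinearMap.lsmul R A x)).comap (LinearMap.lsmul R A u) := by
    refine Finset.sup_le fun N hN m hm => ?_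
    by_cases hNp : N.annihilator.radical ≤ p.asIdeal
    · have hNt : N ∈ t := Finset.mem_filter.mpr ⟨hN, fun q hq hqN =>
        hp (hX q hq ((PrimeSpectrum.mem_zeroLocus _ _).mpr (hqN.trans_le hNp)))⟩
      obtain ⟨m', -, rfl⟩ := (hsec N hN).exists_smul_eq (hx N hNt) hm
      exact ⟨u • m', smul_comm x u m'⟩
    · rw [Submodule.mem_comap, LinearMap.lsmul_apply, hu0 N hN hNp m hm]
      exact Submodule.zero_mem _
  have hz : u • (Localization.mk 1 ⟨u, hu⟩ * z : Localization.AtPrime p.asIdeal) = z := by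
    rw [← smul_mul_assoc, Localization.smul_mk, smul_eq_mul, mul_one,
      Localization.mk_self ⟨u, hu⟩, one_mul]
  rw [← hz, map_smul]
  exact hle (htop ▸ Submodule.mem_top)

end IsLinearlyCompactModule

/-! ### Colon submodules and filter co-regularity in terms of `Hom(R_p, M)` -/

section ColonZero

variable {R : Type*} [CommRing R] {M : Type*} [AddCommGroup M] [Module R M]

theorem mem_colonZero {J : Ideal R} {m : M} : m ∈ colonZero M J ↔ ∀ a ∈ J, a • m = 0 :=
  (Submodule.mem_torsionBySet_iff _ _).trans ⟨fun h a ha => h ⟨a, ha⟩, fun h a => h a a.2⟩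

theorem colonZero_bot : colonZero M (⊥ : Ideal R) = ⊤ := by
  ext m
  simp

theorem colonZero_sup_span_singleton (J : Ideal R) (x : R) :
    colonZero M (J ⊔ Ideal.span {x}) =
      colonZero M J ⊓ LinearMap.ker (LinearMap.lsmul R M x) := by
  ext m
  simp only [Submodule.mem_inf, mem_colonZero, LinearMap.mem_ker, LinearMap.lsmul_apply]
  refine ⟨fun h => ⟨fun a ha => h a (Ideal.mem_sup_left ha),
    h x (Ideal.mem_sup_right (Ideal.mem_span_singleton_self x))⟩, fun ⟨h, hx⟩ a ha => ?_⟩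
  obtain ⟨b, hb, c, hc, rfl⟩ := Submodule.mem_sup.mp ha
  obtain ⟨c, rfl⟩ := Ideal.mem_span_singleton'.mp hc
  rw [add_smul, h b hb, mul_smul, hx, smul_zero, add_zero]

theorem mem_colonZero_hom_iff {P : Type*} [AddCommGroup P] [Module R P] {J : Ideal R}
    {φ : P →ₗ[R] M} : φ ∈ colonZero (P →ₗ[R] M) J ↔ ∀ z, φ z ∈ colonZero M J := by
  simp only [mem_colonZero, LinearMap.ext_iff, LinearMap.smul_apply, LinearMap.zero_apply]
  exact ⟨fun h z a ha => h a ha z, fun h a ha z => h z a ha⟩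

/-- `Hom(P, (0 :_M J))` is `(0 :_{Hom(P, M)} J)`. -/
theorem forall_exists_smul_eq_colonZero_iff {P : Type*} [AddCommGroup P] [Module R P] {J : Ideal R}
    {x : R} : (∀ φ : P →ₗ[R] colonZero M J, ∃ ψ, x • ψ = φ) ↔
      ∀ l ∈ colonZero (P →ₗ[R] M) J, ∃ l' ∈ colonZero (P →ₗ[R] M) J, x • l' = l := by
  constructor
  · intro h l hl
    obtain ⟨ψ, hψ⟩ := h (l.codRestrict _ (mem_colonZero_hom_iff.mp hl))
    refine ⟨(colonZero M J).subtype ∘ₗ ψ, mem_colonZero_hom_iff.mpr fun z => (ψ z).2, ?_⟩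
    exact LinearMap.ext fun z => congrArg Subtype.val (LinearMap.congr_fun hψ z)
  · intro h φ
    obtain ⟨l, hl, hlφ⟩ := h ((colonZero M J).subtype ∘ₗ φ)
      (mem_colonZero_hom_iff.mpr fun z => (φ z).2)
    exact ⟨l.codRestrict _ (mem_colonZero_hom_iff.mp hl),
      LinearMap.ext fun z => Subtype.ext (LinearMap.congr_fun hlφ z)⟩

theorem IsLinearlyCompactModule.colonZero [TopologicalSpace M] (hM : IsLinearlyCompactModule R M)
    (J : Ideal R) : IsLinearlyCompactModule R (colonZero M J) := by
  have := hM.isTopologicalAddGroup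
  have := hM.t2Space
  have := hM.isLinearTopology
  have := IsLinearTopology.continuousConstSMul R M
  refine hM.submodule ?_
  have : (_root_.colonZero M J : Set M) =
      ⋂ a ∈ J, (LinearMap.ker (LinearMap.lsmul R M a) : Set M) := by
    ext m
    simp
  rw [this]
  exact isClosed_biInter fun a _ => LinearMap.isClosed_ker_of_continuous (continuous_const_smul a)

end ColonZero

section FilterCoregular

variable {R : Type*} [CommRing R] {M : Type*} [AddCommGroup M] [Module R M] [TopologicalSpace M]
  {X : Set (PrimeSpectrum R)}

theorem isFilterCoregular_iff (hM : IsLinearlyCompactModule R M) {n : ℕ} {x : Fin n → R} :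
    IsFilterCoregular M X x ↔ ∀ i : Fin n, ∀ p ∉ X,
      ∀ l ∈ colonZero (Localization.AtPrime p.asIdeal →ₗ[R] M) (Ideal.span (x '' Set.Iio i)),
        ∃ l' ∈ colonZero (Localization.AtPrime p.asIdeal →ₗ[R] M) (Ideal.span (x '' Set.Iio i)),
          x i • l' = l := by
  simp only [← forall_exists_smul_eq_colonZero_iff,
    ← (hM.colonZero _).notMem_coSupport_quotient_range_lsmul_iff]
  exact forall_congr' fun i =>
    ⟨fun h p hp hc => hp (h hc), fun h p hc => by_contra fun hp => h p hp hc⟩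

theorem exists_mem_forall_exists_smul_eq_colonZero (hM : IsLinearlyCompactModule R M)
    (hX : IsSaturatedSubset X) {I J : Ideal R} (hI : I.FG)
    (hrep : IsRepresentableModule R (colonZero M J))
    (h : ∀ p ∉ X, colonZero (Localization.AtPrime p.asIdeal →ₗ[R] M) J ≤
      I • colonZero (Localization.AtPrime p.asIdeal →ₗ[R] M) J) :
    ∃ x ∈ I, ∀ p ∉ X, ∀ l ∈ colonZero (Localization.AtPrime p.asIdeal →ₗ[R] M) J,
      ∃ l' ∈ colonZero (Localization.AtPrime p.asIdeal →ₗ[R] M) J, x • l' = l := by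
  simp only [← forall_exists_smul_eq_colonZero_iff]
  refine (hM.colonZero J).exists_mem_forall_exists_smul_eq hrep hX hI fun p hp φ k => ?_
  set K := colonZero (Localization.AtPrime p.asIdeal →ₗ[R] M) J
  -- Iterating `K = I K` and evaluating at `1` places `φ 1` in every `I ^ k (0 :_M J)`.
  have hK : ∀ k : ℕ, K ≤ I ^ k • K := by
    intro k
    induction k with
    | zero => simp
    | succ k ih =>
      rw [pow_succ, Submodule.mul_smul]
      exact ih.trans (smul_mono_right _ (h p hp))
  have hmem : (colonZero M J).subtype ∘ₗ φ ∈ K := mem_colonZero_hom_iff.mpr fun z => (φ z).2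
  have hev : K.map (LinearMap.applyₗ (1 : Localization.AtPrime p.asIdeal)) ≤ colonZero M J := by
    rintro _ ⟨l, hl, rfl⟩
    exact mem_colonZero_hom_iff.mp hl 1
  have h1 : ((φ 1 : colonZero M J) : M) ∈ I ^ k • colonZero M J := by
    have := Submodule.mem_map_of_mem
      (f := LinearMap.applyₗ (R := R) (M₂ := M) (1 : Localization.AtPrime p.asIdeal)) (hK k hmem)
    rw [Submodule.map_smul''] at this
    exact smul_mono_right _ hev this
  have h2 : I ^ k • colonZero M J =
      (I ^ k • (⊤ : Submodule R (colonZero M J))).map (colonZero M J).subtype := by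
    rw [Submodule.map_smul'', Submodule.map_top, Submodule.range_subtype]
  rw [h2] at h1
  obtain ⟨y, hy, hyφ⟩ := h1
  rwa [← Subtype.ext hyφ]

end FilterCoregular

/-! ### The implications between Tor and co-regular sequences -/

variable {R : Type u} [CommRing R] {X : Set (PrimeSpectrum R)} {M : Type u} [AddCommGroup M]
  [Module R M] [TopologicalSpace M]

theorem exists_isFilterCoregular [IsNoetherianRing R] (hX : IsSaturatedSubset X) {I : Ideal R}
    (hM : IsStronglyRepresentable R M) (hMc : IsLinearlyCompactModule R M) {n : ℕ}
    (h : ∀ i < n, coSupport R (torModule R i (R ⧸ I) M) ⊆ X) :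
    ∃ x : Fin n → R, (∀ j, x j ∈ I) ∧ IsFilterCoregular M X x := by
  obtain ⟨P⟩ := FiniteFreeResolution.nonempty (R := R) (R ⧸ I)
  -- After `m` elements exactness survives in degrees below `n - m`; while `m < n` this includes
  -- degree zero, which supplies the next element.
  suffices H : ∀ m ≤ n, ∃ x : Fin m → R, (∀ j, x j ∈ I) ∧ IsFilterCoregular M X x ∧
      ∀ p ∉ X, ∀ i, i + m < n → P.ExactAt
        (colonZero (Localization.AtPrime p.asIdeal →ₗ[R] M) (Ideal.span (Set.range x))) i by
    obtain ⟨x, hxI, hx, -⟩ := H n le_rfl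
    exact ⟨x, hxI, hx⟩
  intro m
  induction m with
  | zero =>
    refine fun _ => ⟨Fin.elim0, fun j => j.elim0, fun j => j.elim0, fun p hp i hi => ?_⟩
    rw [Set.range_eq_empty, Ideal.span_empty, colonZero_bot,
      ← P.notMem_coSupport_torModule_iff M hMc]
    exact fun hc => hp (h i hi hc)
  | succ m ih =>
    intro hm
    obtain ⟨x, hxI, hx, hE⟩ := ih (Nat.le_of_succ_le hm)
    obtain ⟨y, hyI, hy⟩ := exists_mem_forall_exists_smul_eq_colonZero hMc hX
      (IsNoetherian.noetherian I) (hM.2 (Ideal.span (Set.range x)) (IsNoetherian.noetherian _))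
      fun p hp => (hE p hp 0 (by omega)).le_smul
    have himage : ∀ j : Fin m,
        (Fin.snoc x y : Fin (m + 1) → R) '' Set.Iio j.castSucc = x '' Set.Iio j := by
      intro j
      rw [← Fin.image_castSucc_Iio, Set.image_image]
      simp
    have hlast : (Fin.snoc x y : Fin (m + 1) → R) '' Set.Iio (Fin.last m) = Set.range x := by
      rw [show Set.Iio (Fin.last m) = Set.range Fin.castSucc from
        Fin.range_castSucc.symm, ← Set.range_comp]
      simp [Function.comp_def]
    have hrange : Ideal.span (Set.range (Fin.snoc x y : Fin (m + 1) → R)) =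
        Ideal.span (Set.range x) ⊔ Ideal.span {y} := by
      rw [Fin.range_snoc, Ideal.span_insert, sup_comm]
    refine ⟨Fin.snoc x y, fun j => ?_, ?_, fun p hp i hi => ?_⟩
    · induction j using Fin.lastCases with
      | last => simpa using hyI
      | cast j => simpa using hxI j
    · rw [isFilterCoregular_iff hMc] at hx ⊢
      intro j p hp
      induction j using Fin.lastCases with
      | last =>
        rw [hlast, Fin.snoc_last]
        exact hy p hp
      | cast j =>
        rw [himage, Fin.snoc_castSucc]
        exact hx j p hp
    · rw [hrange, colonZero_sup_span_singleton]
      exact FiniteFreeResolution.ExactAt.inf_ker P (hy p hp) (hE p hp i (by omega))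
        (hE p hp (i + 1) (by omega))

theorem IsFilterCoregular.coSupport_torModule_subset [IsNoetherianRing R] {I : Ideal R}
    (hMc : IsLinearlyCompactModule R M) {n : ℕ} {x : Fin n → R} (hxI : ∀ j, x j ∈ I)
    (hx : IsFilterCoregular M X x) (N : Type u) [AddCommGroup N] [Module R N] [Module.Finite R N]
    (hN : Module.support R N ⊆ PrimeSpectrum.zeroLocus (I : Set R)) {i : ℕ} (hi : i < n) :
    coSupport R (torModule R i N M) ⊆ X := by
  obtain ⟨P⟩ := FiniteFreeResolution.nonempty (R := R) N
  have hpow : ∀ j, ∃ k : ℕ, ∀ y : N, x j ^ k • y = 0 := by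
    intro j
    rw [Module.support_eq_zeroLocus, PrimeSpectrum.zeroLocus_subset_zeroLocus_iff] at hN
    obtain ⟨k, hk⟩ := hN (hxI j)
    exact ⟨k, Module.mem_annihilator.mp hk⟩
  intro p hpT
  by_contra hp
  refine (P.notMem_coSupport_torModule_iff M hMc i p).mpr ?_ hpT
  rw [isFilterCoregular_iff hMc] at hx
  -- Here `m` elements have been imposed and `k` remain. Passing from `m + 1` back to `m` gains one
  -- degree, up to all degrees below `n` at `m = 0`.
  suffices H : ∀ k m, m + k = n → ∀ i < k, P.ExactAt
      (colonZero (Localization.AtPrime p.asIdeal →ₗ[R] M)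
        (Ideal.span (x '' {j : Fin n | (j : ℕ) < m}))) i by
    have := H n 0 (Nat.zero_add n) i hi
    simpa [colonZero_bot] using this
  intro k
  induction k with
  | zero => exact fun _ _ i hi => absurd hi (Nat.not_lt_zero i)
  | succ k ih =>
    intro m hm i hi
    let j : Fin n := ⟨m, by omega⟩
    have hj : Set.Iio j = {a : Fin n | (a : ℕ) < m} := rfl
    obtain ⟨e, he⟩ := hpow j
    refine P.exactAt_of_forall_exists_smul_eq he (hj ▸ hx j p hp) fun i' hi' => ?_
    rw [← colonZero_sup_span_singleton, ← Ideal.span_union]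
    have hset : x '' {j : Fin n | (j : ℕ) < m} ∪ {x j} = x '' {j : Fin n | (j : ℕ) < m + 1} := by
      rw [← Set.image_singleton, ← Set.image_union]
      congr 1
      ext a
      simp only [Set.mem_union, Set.mem_ofPred_eq, Set.mem_singleton_iff, Fin.ext_iff, j]
      omega
    rw [hset]
    exact ih (m + 1) (by omega) i' (by omega)

theorem theorem3p7 (R : Type u) [CommRing R] [IsNoetherianRing R]
    (X : Set (PrimeSpectrum R)) (hX : IsSaturatedSubset X) (I : Ideal R)
    (M : Type u) [AddCommGroup M] [Module R M] [TopologicalSpace M]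
    (hM : IsStronglyRepresentable R M) (hMc : IsLinearlyCompactModule R M)
    (n : ℕ) (hn : 0 < n) :
    List.TFAE
      [∀ (N : Type u) [AddCommGroup N] [Module R N], Module.Finite R N →
          Module.support R N ⊆ PrimeSpectrum.zeroLocus (I : Set R) →
          ∀ i < n, coSupport R (torModule R i N M) ⊆ X,
        ∀ i < n, coSupport R (torModule R i (R ⧸ I) M) ⊆ X,
        ∃ x : Fin n → R, (∀ j, x j ∈ I) ∧ IsFilterCoregular M X x] := by
  tfae_have 1 → 2 := fun h => h (R ⧸ I) inferInstance (by
    rw [Module.support_eq_zeroLocus, Ideal.annihilator_quotient])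
  tfae_have 2 → 3 := exists_isFilterCoregular hX hM hMc
  tfae_have 3 → 1 := fun ⟨x, hxI, hx⟩ N _ _ _ hN i hi =>
    hx.coSupport_torModule_subset hMc hxI N hN hi
  tfae_finish
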